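/- Let $K$ be a closed convex subset of $\mathbb{R}^n$, let $\boldsymbol\mu\in\mathbb{R}^n$, let $\sigma>0$ and let $\boldsymbol\xi\sim\mathcal N(\mathbf 0,\sigma^2 I_{n\times n})$. Observe $\mathbf y=\boldsymbol\mu+\boldsymbol\xi$. Write $|\cdot|_2$ for the Euclidean norm and $\|\mathbf v\|^2=\frac1n\sum_{i=1}^n v_i^2$ for the squared scaled norm on $\mathbb{R}^n$, and let $\hat{\boldsymbol\mu}^{\mathrm{LS}}(K)\in\operatorname{argmin}_{\mathbf v\in K}\|\mathbf y-\mathbf v\|^2$ be the least squares estimator over $K$. Assume that for some $\mathbf u\in K$ there exists $t_*>0$ such that $$\mathbb E\sup_{\mathbf v\in K:\ |\mathbf v-\mathbf u|_2\le t_*}\boldsymbol\xi^T(\mathbf v-\mathbf u)\le\frac{t_*^2}{2}.$$ Then for every $x>0$, with probability greater than $1-e^{-x}$, $$\|\hat{\boldsymbol\mu}^{\mathrm{LS}}(K)-\boldsymbol\mu\|^2-\|\mathbf u-\boldsymbol\mu\|^2\le\frac{(t_*+\sigma\sqrt{2x})^2}{n}\le\frac{2t_*^2+4\sigma^2x}{n}.$$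 -/

import Mathlib

open MeasureTheory ProbabilityTheory

/-- The squared scaled norm `(1/n) ∑ᵢ uᵢ²` on `ℝⁿ`. -/
noncomputable def scaledNormSq {n : ℕ} (u : EuclideanSpace ℝ (Fin n)) : ℝ :=
  (1 / (n : ℝ)) * ∑ i, (u i) ^ 2

/-- `θ` is a least squares estimate over `K` from the observation `y`:
`θ ∈ argmin_{u ∈ K} ‖y - u‖²` for the scaled norm. -/
def IsLeastSquares {n : ℕ} (K : Set (EuclideanSpace ℝ (Fin n)))
    (y θ : EuclideanSpace ℝ (Fin n)) : Prop :=
  θ ∈ K ∧ ∀ u ∈ K, scaledNormSq (y - θ) ≤ scaledNormSq (y - u)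

/-- The localized supremum `sup {zᵀ (v - u) : v ∈ K, ‖v - u‖₂ ≤ t}`. For `u ∈ K` and `0 ≤ t` it is
the supremum of a nonempty set of reals bounded above by `t ‖z‖₂`. -/
noncomputable def localizedSup {n : ℕ} (K : Set (EuclideanSpace ℝ (Fin n)))
    (u : EuclideanSpace ℝ (Fin n)) (t : ℝ) (z : EuclideanSpace ℝ (Fin n)) : ℝ :=
  sSup {r : ℝ | ∃ v ∈ K, ‖v - u‖ ≤ t ∧ r = inner ℝ z (v - u)}

/-!
Strong convexity of the squared distance gives, for a least squares estimate `θ` over the convex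
set `K`, the basic inequality `|θ - μ|² - |u - μ|² ≤ 2 ⟪ξ, θ - u⟫ - |θ - u|²`. If `θ` lies outside
the ball of radius `t` around `u`, the segment from `u` to `θ` crosses the sphere inside `K`, so in
all cases the right-hand side is controlled by the localized supremum `h ξ` over `K` intersected
with the ball: it is at most `(t + a)²` as soon as `h ξ ≤ t² / 2 + t a + δ`, with
`δ = min (a², t²) / 2` (`IsLeastSquares.scaledNormSq_sub_le`). The margin `δ > 0` is what makes the
probability bound strict.

It remains to bound the upper tail of `h ξ`, the support function of a closed convex set in the ball
of radius `t`, by the Gaussian concentration inequality with its sharp constant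
(`measure_supportFunction_ge_le`). The moment generating function is bounded first for a Lipschitz
function `f` whose first-order expansion has a uniform quadratic remainder. Over a Gaussian step of
small size `s`, such an `f` is linear up to `O(s²)`, hence its variance is at most `s² L² + O(s³)`,
and a Taylor expansion gives `∫ exp (f (z + s y)) ≤ exp (∫ f (z + s y) + s² L² / 2 + O(s³))`
(`IsSmoothLipschitz.integral_exp_step_le`). Averaging over a Gaussian step keeps `f` in the same
class with the same constants, so a standard Gaussian vector can be split into `k` independent steps
of size `1 / √k`; the accumulated error is `O(1 / √k)`, which vanishes as `k → ∞`
(`IsSmoothLipschitz.integral_exp_le`). Support functions are reached through their Moreau envelopes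
(`exists_isSmoothLipschitz_approx`), and Chernoff's bound concludes.
-/

open Filter Topology

/-! ### Gaussian integrability and stability -/

section Gaussian

variable {E : Type*} [NormedAddCommGroup E] [InnerProductSpace ℝ E] [FiniteDimensional ℝ E]
  [MeasurableSpace E] [BorelSpace E]

lemma integrable_exp_mul_norm_stdGaussian (a : ℝ) :
    Integrable (fun y : E ↦ Real.exp (a * ‖y‖)) (stdGaussian E) := by
  obtain ⟨C, hC, hint⟩ := IsGaussian.exists_integrable_exp_sq (stdGaussian E)
  refine (hint.const_mul (Real.exp (a ^ 2 / (4 * C)))).mono'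
    (Continuous.aestronglyMeasurable (by fun_prop)) (ae_of_all _ fun y ↦ ?_)
  rw [Real.norm_of_nonneg (Real.exp_pos _).le, ← Real.exp_add]
  refine Real.exp_le_exp.2 ?_
  have h : a ^ 2 / (4 * C) + C * ‖y‖ ^ 2 - a * ‖y‖ = (a - 2 * C * ‖y‖) ^ 2 / (4 * C) := by
    field_simp
    ring
  have : 0 ≤ (a - 2 * C * ‖y‖) ^ 2 / (4 * C) := by positivity
  linarith

lemma integrable_norm_stdGaussian : Integrable (fun y : E ↦ ‖y‖) (stdGaussian E) :=
  IsGaussian.integrable_id.norm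

lemma integral_inner_sq_stdGaussian (w : E) :
    ∫ y, (inner ℝ w y) ^ 2 ∂(stdGaussian E) = ‖w‖ ^ 2 := by
  have h := variance_dual_stdGaussian (innerSL ℝ w)
  rw [variance_eq_sub (IsGaussian.memLp_dual _ _ _ (by simp)),
    integral_strongDual_stdGaussian, innerSL_apply_norm] at h
  simpa using h

/-- Gaussian vectors are stable: a linear combination of two independent standard Gaussian
vectors is again a multiple of a standard Gaussian vector. -/
lemma map_prod_stdGaussian {a b c : ℝ} (h : a ^ 2 + b ^ 2 = c ^ 2) :
    ((stdGaussian E).prod (stdGaussian E)).map (fun p ↦ a • p.1 + b • p.2) =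
      (stdGaussian E).map (c • ·) := by
  have h1 : ((stdGaussian E).prod (stdGaussian E)).map (fun p ↦ a • p.1 + b • p.2) =
      ((stdGaussian E).map (a • ·)) ∗ ((stdGaussian E).map (b • ·)) := by
    rw [Measure.conv, Measure.map_prod_map _ _ (by fun_prop) (by fun_prop),
      Measure.map_map (by fun_prop) (by fun_prop)]
    rfl
  have : IsProbabilityMeasure ((stdGaussian E).map (a • · : E → E)) :=
    Measure.isProbabilityMeasure_map (by fun_prop)
  have : IsProbabilityMeasure ((stdGaussian E).map (b • · : E → E)) :=
    Measure.isProbabilityMeasure_map (by fun_prop)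
  have : IsProbabilityMeasure ((stdGaussian E).map (c • · : E → E)) :=
    Measure.isProbabilityMeasure_map (by fun_prop)
  rw [h1]
  apply Measure.ext_of_charFun
  ext t
  rw [charFun_conv]
  simp only [charFun_map_smul, charFun_stdGaussian, norm_smul, ← Complex.exp_add]
  congr 1
  have h2 : (a : ℂ) ^ 2 + (b : ℂ) ^ 2 = (c : ℂ) ^ 2 := by exact_mod_cast h
  have key (r : ℝ) : ((‖r‖ * ‖t‖ : ℝ) : ℂ) ^ 2 = (r : ℂ) ^ 2 * (‖t‖ : ℂ) ^ 2 := by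
    rw [← Complex.ofReal_pow, mul_pow, Real.norm_eq_abs, sq_abs]
    push_cast
    ring
  rw [key, key, key, ← h2]
  ring

lemma integrable_prod_stdGaussian {a b c : ℝ} (h : a ^ 2 + b ^ 2 = c ^ 2) {g : E → ℝ}
    (hg : Continuous g) (hint : Integrable (fun z ↦ g (c • z)) (stdGaussian E)) :
    Integrable (fun p : E × E ↦ g (a • p.1 + b • p.2))
      ((stdGaussian E).prod (stdGaussian E)) := by
  have h1 : Integrable g ((stdGaussian E).map (c • ·)) :=
    (integrable_map_measure hg.aestronglyMeasurable (by fun_prop)).2 hint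
  rw [← map_prod_stdGaussian h] at h1
  exact (integrable_map_measure hg.aestronglyMeasurable (by fun_prop)).1 h1

lemma integral_integral_stdGaussian {a b c : ℝ} (h : a ^ 2 + b ^ 2 = c ^ 2) {g : E → ℝ}
    (hg : Continuous g) (hint : Integrable (fun z ↦ g (c • z)) (stdGaussian E)) :
    ∫ z, g (c • z) ∂(stdGaussian E) =
      ∫ x, ∫ y, g (a • x + b • y) ∂(stdGaussian E) ∂(stdGaussian E) := by
  rw [← integral_prod _ (integrable_prod_stdGaussian h hg hint),
    ← integral_map (φ := (c • · : E → E)) (by fun_prop) hg.aestronglyMeasurable,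
    ← map_prod_stdGaussian h, integral_map (by fun_prop) hg.aestronglyMeasurable]

end Gaussian

/-! ### Lipschitz functions with a quadratic remainder -/

section Smooth

variable {E : Type*} [NormedAddCommGroup E] [InnerProductSpace ℝ E]

/-- `f` is `L`-Lipschitz and has a first-order expansion at every point, with gradient `w` of norm
at most `L` and remainder at most `C ‖h‖²`. The gradient is carried along as a measurable field,
so that it can be averaged. -/
structure IsSmoothLipschitz [MeasurableSpace E] (L C : ℝ) (f : E → ℝ) (w : E → E) : Prop where
  const_nonneg : 0 ≤ C
  measurable_grad : Measurable w
  norm_grad_le : ∀ z, ‖w z‖ ≤ L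
  abs_sub_le : ∀ z h, |f (z + h) - f z| ≤ L * ‖h‖
  abs_remainder_le : ∀ z h, |f (z + h) - f z - inner ℝ (w z) h| ≤ C * ‖h‖ ^ 2

namespace IsSmoothLipschitz

variable [MeasurableSpace E] {L C : ℝ} {f : E → ℝ} {w : E → E}

lemma nonneg (hf : IsSmoothLipschitz L C f w) : 0 ≤ L := (norm_nonneg _).trans (hf.norm_grad_le 0)

lemma continuous (hf : IsSmoothLipschitz L C f w) : Continuous f := by
  refine (LipschitzWith.of_dist_le_mul (K := L.toNNReal) fun x y ↦ ?_).continuous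
  rw [Real.coe_toNNReal _ hf.nonneg, Real.dist_eq, dist_eq_norm]
  simpa using hf.abs_sub_le y (x - y)

lemma comp_smul [BorelSpace E] [SecondCountableTopology E]
    (hf : IsSmoothLipschitz L C f w) {a b : ℝ} (ha : 0 ≤ a) (hb : 0 ≤ b) :
    IsSmoothLipschitz (a * b * L) (a * b ^ 2 * C) (fun z ↦ a * f (b • z))
      (fun z ↦ (a * b) • w (b • z)) where
  const_nonneg := mul_nonneg (by positivity) hf.const_nonneg
  measurable_grad := (hf.measurable_grad.comp (measurable_const_smul b)).const_smul _
  norm_grad_le z := by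
    rw [norm_smul, Real.norm_of_nonneg (by positivity)]
    exact mul_le_mul_of_nonneg_left (hf.norm_grad_le _) (by positivity)
  abs_sub_le z h := by
    have := mul_le_mul_of_nonneg_left (hf.abs_sub_le (b • z) (b • h)) ha
    rw [norm_smul, Real.norm_of_nonneg hb] at this
    rw [smul_add, ← mul_sub, abs_mul, abs_of_nonneg ha]
    linarith
  abs_remainder_le z h := by
    have := mul_le_mul_of_nonneg_left (hf.abs_remainder_le (b • z) (b • h)) ha
    rw [norm_smul, Real.norm_of_nonneg hb, inner_smul_right] at this
    rw [smul_add, inner_smul_left]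
    simp only [conj_trivial]
    rw [show a * f (b • z + b • h) - a * f (b • z) - a * b * inner ℝ (w (b • z)) h =
      a * (f (b • z + b • h) - f (b • z) - b * inner ℝ (w (b • z)) h) by ring, abs_mul,
      abs_of_nonneg ha]
    linarith

variable [FiniteDimensional ℝ E] [BorelSpace E]

lemma integrable (hf : IsSmoothLipschitz L C f w) (z : E) (s : ℝ) :
    Integrable (fun y ↦ f (z + s • y)) (stdGaussian E) := by
  refine ((integrable_const (|f z|)).add
    ((integrable_norm_stdGaussian (E := E)).const_mul (L * |s|))).mono'
    (hf.continuous.comp (by fun_prop)).aestronglyMeasurable (ae_of_all _ fun y ↦ ?_)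
  have h := hf.abs_sub_le z (s • y)
  rw [norm_smul, Real.norm_eq_abs] at h
  have h2 := abs_sub_abs_le_abs_sub (f (z + s • y)) (f z)
  simp only [Pi.add_apply, Real.norm_eq_abs]
  linarith

lemma integrable_exp (hf : IsSmoothLipschitz L C f w) (z : E) (s : ℝ) :
    Integrable (fun y ↦ Real.exp (f (z + s • y))) (stdGaussian E) := by
  refine ((integrable_exp_mul_norm_stdGaussian (E := E) (L * |s|)).const_mul
    (Real.exp (f z))).mono' (Real.continuous_exp.comp
      (hf.continuous.comp (by fun_prop))).aestronglyMeasurable (ae_of_all _ fun y ↦ ?_)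
  have h := le_of_abs_le (hf.abs_sub_le z (s • y))
  rw [norm_smul, Real.norm_eq_abs] at h
  rw [Real.norm_of_nonneg (Real.exp_pos _).le, ← Real.exp_add]
  exact Real.exp_le_exp.2 (by linarith)

/-- Averaging over a Gaussian perturbation preserves the class. -/
lemma integral_add_smul (hf : IsSmoothLipschitz L C f w) (s : ℝ) :
    IsSmoothLipschitz L C (fun z ↦ ∫ y, f (z + s • y) ∂(stdGaussian E))
      (fun z ↦ ∫ y, w (z + s • y) ∂(stdGaussian E)) := by
  have hw (z : E) : Integrable (fun y ↦ w (z + s • y)) (stdGaussian E) :=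
    (integrable_const L).mono' (hf.measurable_grad.comp (by fun_prop)).aestronglyMeasurable
      (ae_of_all _ fun y ↦ hf.norm_grad_le _)
  refine ⟨hf.const_nonneg, ?_, fun z ↦ ?_, fun z h ↦ ?_, fun z h ↦ ?_⟩
  · exact (StronglyMeasurable.integral_prod_right'
      (f := fun p : E × E ↦ w (p.1 + s • p.2))
      (hf.measurable_grad.comp (by fun_prop)).stronglyMeasurable).measurable
  · simpa using norm_integral_le_of_norm_le_const (μ := stdGaussian E)
      (ae_of_all _ fun y ↦ hf.norm_grad_le (z + s • y))
  · rw [← integral_sub (hf.integrable _ _) (hf.integrable _ _)]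
    have := norm_integral_le_of_norm_le_const (μ := stdGaussian E) (C := L * ‖h‖)
      (f := fun y ↦ f (z + h + s • y) - f (z + s • y)) (ae_of_all _ fun y ↦ by
        rw [add_right_comm]
        exact hf.abs_sub_le (z + s • y) h)
    simpa using this
  · have h1 : inner ℝ (∫ y, w (z + s • y) ∂(stdGaussian E)) h =
        ∫ y, inner ℝ (w (z + s • y)) h ∂(stdGaussian E) := by
      rw [real_inner_comm, ← integral_inner (hw z)]
      simp_rw [real_inner_comm]
    rw [h1, ← integral_sub (hf.integrable _ _) (hf.integrable _ _),
      ← integral_sub (by exact (hf.integrable _ _).sub (hf.integrable _ _))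
        ((hw z).inner_const h)]
    have := norm_integral_le_of_norm_le_const (μ := stdGaussian E) (C := C * ‖h‖ ^ 2)
      (f := fun y ↦ f (z + h + s • y) - f (z + s • y) - inner ℝ (w (z + s • y)) h)
      (ae_of_all _ fun y ↦ by
        rw [add_right_comm]
        exact hf.abs_remainder_le (z + s • y) h)
    simpa using this

end IsSmoothLipschitz

end Smooth

/-! ### The moment generating function of a smooth Lipschitz function -/

section MomentGenerating

lemma Real.exp_le_taylor_two_add (d : ℝ) :
    Real.exp d ≤ 1 + d + d ^ 2 / 2 + |d| ^ 3 * Real.exp |d| := by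
  have h := Complex.norm_exp_sub_sum_le_norm_mul_exp (d : ℂ) 3
  rw [Complex.norm_real, Real.norm_eq_abs] at h
  have h2 : Complex.exp d - ∑ m ∈ Finset.range 3, (d : ℂ) ^ m / (m.factorial : ℂ) =
      ((Real.exp d - (1 + d + d ^ 2 / 2) : ℝ) : ℂ) := by
    simp [Finset.sum_range_succ]
  rw [h2, Complex.norm_real, Real.norm_eq_abs] at h
  linarith [le_of_abs_le h]

lemma Real.pow_le_factorial_mul_exp {r : ℝ} (hr : 0 ≤ r) (k : ℕ) :
    r ^ k ≤ k.factorial * Real.exp r := by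
  have := Real.pow_div_factorial_le_exp r hr k
  rwa [div_le_iff₀ (by positivity), mul_comm] at this

namespace IsSmoothLipschitz

variable {E : Type*} [NormedAddCommGroup E] [InnerProductSpace ℝ E] [MeasurableSpace E]
  {L C : ℝ} {f : E → ℝ} {w : E → E}

/-- The squared increment is the square of its linear part up to order `s³`. The powers of `‖y‖` in
the error are absorbed by `‖y‖ ^ k ≤ k! * exp ‖y‖`. -/
lemma sq_sub_le (hf : IsSmoothLipschitz L C f w) (z : E) {s : ℝ} (hs : 0 ≤ s) (hs1 : s ≤ 1)
    (y : E) :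
    (f (z + s • y) - f z) ^ 2 ≤
      s ^ 2 * (inner ℝ (w z) y) ^ 2 + s ^ 3 * ((12 * (C * L) + 24 * C ^ 2) * Real.exp ‖y‖) := by
  have hL := hf.nonneg
  have hr := hf.abs_remainder_le z (s • y)
  rw [inner_smul_right, norm_smul, Real.norm_of_nonneg hs, mul_pow] at hr
  set a := inner ℝ (w z) y
  set F := f (z + s • y) - f z
  have ha : |a| ≤ L * ‖y‖ := (abs_real_inner_le_norm _ _).trans (by
    gcongr
    exact hf.norm_grad_le z)
  set q := F - s * a
  have hF : F = s * a + q := by ring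
  have hy := norm_nonneg y
  have h3 := Real.pow_le_factorial_mul_exp hy 3
  have h4 := Real.pow_le_factorial_mul_exp hy 4
  norm_num [Nat.factorial] at h3 h4
  have hC := hf.const_nonneg
  have hq : |q| ≤ s ^ 2 * (C * ‖y‖ ^ 2) := by linarith
  have h5 : s * a * q ≤ s ^ 3 * (6 * (C * L) * Real.exp ‖y‖) := by
    calc s * a * q ≤ |s * a * q| := le_abs_self _
      _ = s * |a| * |q| := by rw [abs_mul, abs_mul, abs_of_nonneg hs]
      _ ≤ s * (L * ‖y‖) * (s ^ 2 * (C * ‖y‖ ^ 2)) := by gcongr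
      _ = s ^ 3 * ((C * L) * ‖y‖ ^ 3) := by ring
      _ ≤ s ^ 3 * ((C * L) * (6 * Real.exp ‖y‖)) := by gcongr
      _ = _ := by ring
  have h6 : q ^ 2 ≤ s ^ 3 * (24 * C ^ 2 * Real.exp ‖y‖) := by
    calc q ^ 2 = |q| ^ 2 := (sq_abs q).symm
      _ ≤ (s ^ 2 * (C * ‖y‖ ^ 2)) ^ 2 := by gcongr
      _ = s * (s ^ 3 * (C ^ 2 * ‖y‖ ^ 4)) := by ring
      _ ≤ 1 * (s ^ 3 * (C ^ 2 * ‖y‖ ^ 4)) := by gcongr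
      _ ≤ 1 * (s ^ 3 * (C ^ 2 * (24 * Real.exp ‖y‖))) := by gcongr
      _ = _ := by ring
  rw [hF]
  nlinarith [h5, h6]

variable [FiniteDimensional ℝ E] [BorelSpace E]

/-- The constant of the third-order error in `integral_exp_step_le`. -/
noncomputable def stepConst (E : Type*) [NormedAddCommGroup E] [InnerProductSpace ℝ E]
    [FiniteDimensional ℝ E] [MeasurableSpace E] [BorelSpace E] (L C : ℝ) : ℝ :=
  (6 * (C * L) + 12 * C ^ 2) * ∫ y, Real.exp ‖y‖ ∂(stdGaussian E) +
    6 * (Real.exp (2 * (L * ∫ y, ‖y‖ ∂(stdGaussian E))) *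
      ∫ y, Real.exp (2 * L * ‖y‖) ∂(stdGaussian E))

/-- For a Gaussian step of size `s`, the exact variance bound `s² L²` holds up to an error of order
`s³`, since `f` is linear to first order. -/
lemma integral_exp_step_le (hf : IsSmoothLipschitz L C f w) (z : E) {s : ℝ} (hs : 0 ≤ s)
    (hs1 : s ≤ 1) :
    ∫ y, Real.exp (f (z + s • y)) ∂(stdGaussian E) ≤
      Real.exp (∫ y, f (z + s • y) ∂(stdGaussian E) +
        (s ^ 2 * L ^ 2 / 2 + s ^ 3 * stepConst E L C)) := by
  have hL := hf.nonneg
  set γ := stdGaussian E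
  set m := ∫ y, f (z + s • y) ∂γ with hm
  set c := ∫ y, ‖y‖ ∂γ with hc
  have hc0 : 0 ≤ c := integral_nonneg fun y ↦ norm_nonneg y
  have hint := hf.integrable z s
  have hE1 : Integrable (fun y : E ↦ Real.exp ‖y‖) γ := by
    simpa using integrable_exp_mul_norm_stdGaussian (E := E) 1
  have hE2 := integrable_exp_mul_norm_stdGaussian (E := E) (2 * L)
  have hI : Integrable (fun y : E ↦ (inner ℝ (w z) y) ^ 2) γ :=
    (IsGaussian.memLp_dual γ (innerSL ℝ (w z)) 2 (by simp)).integrable_sq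
  have hF0 : m - f z = ∫ y, (f (z + s • y) - f z) ∂γ := by
    rw [integral_sub hint (integrable_const _)]
    simp [hm, γ]
  -- the deviation from the mean is at most `s L (‖y‖ + c)`
  have hmz : |m - f z| ≤ s * (L * c) := by
    rw [hF0]
    refine (abs_integral_le_integral_abs).trans ?_
    rw [hc, ← integral_const_mul, ← integral_const_mul]
    refine integral_mono (hint.sub (integrable_const _)).abs
      ((integrable_norm_stdGaussian.const_mul L).const_mul s) fun y ↦ ?_
    have := hf.abs_sub_le z (s • y)
    rw [norm_smul, Real.norm_of_nonneg hs] at this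
    linarith
  have hD (y : E) : |f (z + s • y) - m| ≤ s * (L * (‖y‖ + c)) := by
    have h1 := hf.abs_sub_le z (s • y)
    rw [norm_smul, Real.norm_of_nonneg hs] at h1
    have h2 := _root_.abs_sub_le (f (z + s • y)) (f z) m
    rw [abs_sub_comm (f z) m] at h2
    linarith
  have hcube (y : E) : |f (z + s • y) - m| ^ 3 * Real.exp |f (z + s • y) - m| ≤
      s ^ 3 * (6 * (Real.exp (2 * (L * c)) * Real.exp (2 * L * ‖y‖))) := by
    set R := L * (‖y‖ + c)
    have hR : 0 ≤ R := by positivity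
    have h3 := Real.pow_le_factorial_mul_exp hR 3
    norm_num [Nat.factorial] at h3
    have h1 : |f (z + s • y) - m| ≤ R := (hD y).trans (mul_le_of_le_one_left hR hs1)
    calc |f (z + s • y) - m| ^ 3 * Real.exp |f (z + s • y) - m|
        ≤ (s * R) ^ 3 * Real.exp R := by gcongr; exact hD y
      _ = s ^ 3 * (R ^ 3 * Real.exp R) := by ring
      _ ≤ s ^ 3 * (6 * Real.exp R * Real.exp R) := by gcongr
      _ = s ^ 3 * (6 * (Real.exp (2 * (L * c)) * Real.exp (2 * L * ‖y‖))) := by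
        rw [mul_assoc, ← Real.exp_add, ← Real.exp_add,
          show R + R = 2 * (L * c) + 2 * L * ‖y‖ by simp only [R]; ring]
  -- the centred square is expanded around `f z`, and `-(m - f z)²` is dropped after integrating
  have hpt (y : E) : Real.exp (f (z + s • y)) ≤ Real.exp m *
      (1 + (f (z + s • y) - m) + ((s ^ 2 * (inner ℝ (w z) y) ^ 2 +
        s ^ 3 * ((12 * (C * L) + 24 * C ^ 2) * Real.exp ‖y‖)) / 2
        - (m - f z) * (f (z + s • y) - m) - (m - f z) ^ 2 / 2) +
        s ^ 3 * (6 * (Real.exp (2 * (L * c)) * Real.exp (2 * L * ‖y‖)))) := by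
    have h1 := Real.exp_le_taylor_two_add (f (z + s • y) - m)
    have h2 := hf.sq_sub_le z hs hs1 y
    rw [show f (z + s • y) = m + (f (z + s • y) - m) by ring, Real.exp_add,
      ← show f (z + s • y) = m + (f (z + s • y) - m) by ring]
    refine mul_le_mul_of_nonneg_left ?_ (Real.exp_pos _).le
    have h3 : (f (z + s • y) - m) ^ 2 = (f (z + s • y) - f z) ^ 2
        - 2 * (m - f z) * (f (z + s • y) - m) - (m - f z) ^ 2 := by ring
    linarith [hcube y]
  have hDint : Integrable (fun y ↦ f (z + s • y) - m) γ := hint.sub (integrable_const _)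
  have hD0 : ∫ y, (f (z + s • y) - m) ∂γ = 0 := by
    rw [integral_sub hint (integrable_const _)]
    simp [hm, γ]
  have i1 : Integrable (fun y ↦ 1 + (f (z + s • y) - m)) γ := (integrable_const _).add hDint
  have i2 : Integrable (fun y ↦ (s ^ 2 * (inner ℝ (w z) y) ^ 2 +
        s ^ 3 * ((12 * (C * L) + 24 * C ^ 2) * Real.exp ‖y‖)) / 2) γ :=
    ((hI.const_mul _).add ((hE1.const_mul _).const_mul _)).div_const 2
  have i3 : Integrable (fun y ↦ (m - f z) * (f (z + s • y) - m)) γ := hDint.const_mul _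
  have i4 : Integrable (fun y : E ↦ s ^ 3 * (6 * (Real.exp (2 * (L * c)) *
      Real.exp (2 * L * ‖y‖)))) γ := ((hE2.const_mul _).const_mul _).const_mul _
  have i5 : Integrable (fun _ : E ↦ (m - f z) ^ 2 / 2) γ := integrable_const _
  have hmain := integral_mono (hf.integrable_exp z s)
    (((i1.add ((i2.sub i3).sub i5)).add i4).const_mul (Real.exp m)) hpt
  simp only [Pi.add_apply, Pi.sub_apply] at hmain
  refine hmain.trans ?_
  rw [integral_const_mul, Real.exp_add]
  refine mul_le_mul_of_nonneg_left ?_ (Real.exp_pos _).le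
  have e : ∫ y, (1 + (f (z + s • y) - m) + ((s ^ 2 * (inner ℝ (w z) y) ^ 2 +
        s ^ 3 * ((12 * (C * L) + 24 * C ^ 2) * Real.exp ‖y‖)) / 2
        - (m - f z) * (f (z + s • y) - m) - (m - f z) ^ 2 / 2) +
        s ^ 3 * (6 * (Real.exp (2 * (L * c)) * Real.exp (2 * L * ‖y‖)))) ∂γ =
      1 + (s ^ 2 * ‖w z‖ ^ 2 / 2 + s ^ 3 * stepConst E L C) - (m - f z) ^ 2 / 2 := by
    rw [integral_add (by exact i1.add ((i2.sub i3).sub i5)) i4,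
      integral_add i1 (by exact (i2.sub i3).sub i5), integral_sub (by exact i2.sub i3) i5,
      integral_sub i2 i3, integral_add (integrable_const _) hDint, integral_div,
      integral_add (hI.const_mul _) ((hE1.const_mul _).const_mul _)]
    simp only [integral_const_mul, integral_const, hD0, integral_inner_sq_stdGaussian, γ]
    simp only [probReal_univ, smul_eq_mul, stepConst]
    ring
  rw [e]
  have h1 := Real.add_one_le_exp (s ^ 2 * L ^ 2 / 2 + s ^ 3 * stepConst E L C)
  have h2 : s ^ 2 * ‖w z‖ ^ 2 ≤ s ^ 2 * L ^ 2 := by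
    gcongr
    exact hf.norm_grad_le z
  have h3 := sq_nonneg (m - f z)
  linarith

/-- Splitting a Gaussian vector into `k` independent steps and integrating them out one by one
accumulates `k` times the one-step error. -/
lemma integral_exp_iterate_le {s : ℝ} (hs : 0 ≤ s) (hs1 : s ≤ 1) (k : ℕ) :
    ∀ {f : E → ℝ} {w : E → E}, IsSmoothLipschitz L C f w →
    ∫ z, Real.exp (f ((√k * s) • z)) ∂(stdGaussian E) ≤
      Real.exp (∫ z, f ((√k * s) • z) ∂(stdGaussian E) +
        k * (s ^ 2 * L ^ 2 / 2 + s ^ 3 * stepConst E L C)) := by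
  induction k with
  | zero => intro f w _; simp
  | succ k ih =>
    intro f w hf
    set δ := s ^ 2 * L ^ 2 / 2 + s ^ 3 * stepConst E L C
    have hc : (√k * s) ^ 2 + s ^ 2 = (√(k + 1 : ℕ) * s) ^ 2 := by
      rw [mul_pow, mul_pow, Real.sq_sqrt (by positivity), Real.sq_sqrt (by positivity)]
      push_cast
      ring
    have hP := hf.integral_add_smul s
    have hexp := hf.integrable_exp 0 (√(k + 1 : ℕ) * s)
    have hint := hf.integrable 0 (√(k + 1 : ℕ) * s)
    have hPe := hP.integrable_exp 0 (√k * s)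
    simp only [zero_add] at hexp hint hPe
    have hcexp : Continuous fun z ↦ Real.exp (f z) := Real.continuous_exp.comp hf.continuous
    rw [integral_integral_stdGaussian hc hcexp hexp,
      integral_integral_stdGaussian hc hf.continuous hint]
    calc ∫ x, ∫ y, Real.exp (f ((√k * s) • x + s • y)) ∂(stdGaussian E) ∂(stdGaussian E)
        ≤ ∫ x, Real.exp δ * Real.exp (∫ y, f ((√k * s) • x + s • y) ∂(stdGaussian E))
            ∂(stdGaussian E) := by
          refine integral_mono (integrable_prod_stdGaussian hc hcexp hexp).integral_prod_left
            (hPe.const_mul _) fun x ↦ ?_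
          simp only
          rw [← Real.exp_add, add_comm δ]
          exact hf.integral_exp_step_le _ hs hs1
      _ ≤ Real.exp δ * Real.exp (∫ x, ∫ y, f ((√k * s) • x + s • y)
            ∂(stdGaussian E) ∂(stdGaussian E) + k * δ) := by
          rw [integral_const_mul]
          exact mul_le_mul_of_nonneg_left (ih hP) (Real.exp_pos _).le
      _ = _ := by
          rw [← Real.exp_add]
          congr 1
          push_cast
          ring

/-- The sharp sub-Gaussian bound for smooth Lipschitz functions, obtained by letting the number of
steps tend to infinity. -/
theorem integral_exp_le (hf : IsSmoothLipschitz L C f w) :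
    ∫ z, Real.exp (f z) ∂(stdGaussian E) ≤
      Real.exp (∫ z, f z ∂(stdGaussian E) + L ^ 2 / 2) := by
  have hlim : Tendsto (fun k : ℕ ↦ Real.exp (∫ z, f z ∂(stdGaussian E) +
      (L ^ 2 / 2 + (√(k + 1 : ℕ))⁻¹ * stepConst E L C))) atTop
      (𝓝 (Real.exp (∫ z, f z ∂(stdGaussian E) + (L ^ 2 / 2 + 0 * stepConst E L C)))) := by
    refine (Real.continuous_exp.tendsto _).comp (tendsto_const_nhds.add
      (tendsto_const_nhds.add (Tendsto.mul_const _ ?_)))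
    exact tendsto_inv_atTop_zero.comp (Real.tendsto_sqrt_atTop.comp
      (tendsto_natCast_atTop_atTop.comp (tendsto_add_atTop_nat 1)))
  rw [zero_mul, add_zero] at hlim
  refine ge_of_tendsto' hlim fun k ↦ ?_
  have hpos : (0 : ℝ) < √(k + 1 : ℕ) := Real.sqrt_pos.2 (by positivity)
  have hone : (1 : ℝ) ≤ √(k + 1 : ℕ) :=
    Real.one_le_sqrt.2 (by push_cast; linarith [k.cast_nonneg (α := ℝ)])
  have hsq : (√(k + 1 : ℕ)) ^ 2 = ((k + 1 : ℕ) : ℝ) := Real.sq_sqrt (by positivity)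
  have h := integral_exp_iterate_le (inv_nonneg.2 hpos.le) (inv_le_one_of_one_le₀ hone) (k + 1) hf
  rw [mul_inv_cancel₀ hpos.ne'] at h
  simp only [one_smul] at h
  refine h.trans_eq ?_
  rw [← hsq]
  generalize √(k + 1 : ℕ) = r at hpos
  rw [Real.sqrt_sq hpos.le]
  congr 2
  field_simp

end IsSmoothLipschitz

end MomentGenerating

/-! ### Gaussian concentration of support functions -/

section SupportFunction

variable {E : Type*} [NormedAddCommGroup E] [InnerProductSpace ℝ E]

/-- A support function is approximated from below by its Moreau envelope
`z ↦ max_{v ∈ A} ⟪z, v⟫ - ε ‖v‖² / 2`, whose gradient at `z` is the projection of `ε⁻¹ z` onto `A`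
and hence is `ε⁻¹`-Lipschitz. -/
lemma exists_isSmoothLipschitz_approx [CompleteSpace E] [MeasurableSpace E] [BorelSpace E]
    {A : Set E} (hne : A.Nonempty) (hclosed : IsClosed A) (hconv : Convex ℝ A) {R : ℝ}
    (hR : ∀ v ∈ A, ‖v‖ ≤ R) {h : E → ℝ} (hlub : ∀ z, IsLUB ((fun v ↦ inner ℝ z v) '' A) (h z))
    {ε : ℝ} (hε : 0 < ε) :
    ∃ f w, IsSmoothLipschitz R ε⁻¹ f w ∧ ∀ z, f z ≤ h z ∧ h z ≤ f z + ε * R ^ 2 / 2 := by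
  choose w hwA hw using fun z : E ↦
    exists_norm_eq_iInf_of_complete_convex hne hclosed.isComplete hconv (ε⁻¹ • z)
  have hvar (z : E) {v : E} (hv : v ∈ A) :
      inner ℝ z (v - w z) ≤ ε * inner ℝ (w z) (v - w z) := by
    have h1 := (norm_eq_iInf_iff_real_inner_le_zero hconv (hwA z)).1 (hw z) v hv
    rw [inner_sub_left, inner_smul_left, sub_nonpos] at h1
    simp only [conj_trivial] at h1
    rwa [inv_mul_le_iff₀ hε] at h1
  have hmax (z : E) {v : E} (hv : v ∈ A) :
      inner ℝ z v - ε * ‖v‖ ^ 2 / 2 ≤ inner ℝ z (w z) - ε * ‖w z‖ ^ 2 / 2 := by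
    have h1 := hvar z hv
    have h2 := mul_nonneg hε.le (sq_nonneg ‖v - w z‖)
    rw [norm_sub_sq_real] at h2
    rw [inner_sub_right, inner_sub_right, real_inner_self_eq_norm_sq,
      real_inner_comm v (w z)] at h1
    linarith
  set f : E → ℝ := fun z ↦ inner ℝ z (w z) - ε * ‖w z‖ ^ 2 / 2 with hf
  have hlow (z k : E) : inner ℝ (w z) k ≤ f (z + k) - f z := by
    have := hmax (z + k) (hwA z)
    rw [inner_add_left, real_inner_comm (w z) k] at this
    simp only [hf]
    linarith
  have hupp (z k : E) : f (z + k) - f z ≤ inner ℝ (w (z + k)) k := by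
    have := hmax z (hwA (z + k))
    simp only [hf]
    rw [inner_add_left, real_inner_comm (w (z + k)) k]
    linarith
  have hmono (z k : E) : ε * ‖w (z + k) - w z‖ ^ 2 ≤ inner ℝ k (w (z + k) - w z) := by
    have h1 := hvar z (hwA (z + k))
    have h2 := hvar (z + k) (hwA z)
    rw [← neg_sub, inner_neg_right, inner_neg_right, inner_add_left] at h2
    rw [← real_inner_self_eq_norm_sq, inner_sub_left]
    linarith
  have hlip (z k : E) : ‖w (z + k) - w z‖ ≤ ε⁻¹ * ‖k‖ := by
    rw [le_inv_mul_iff₀ hε]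
    rcases (norm_nonneg (w (z + k) - w z)).eq_or_lt with h0 | h0
    · rw [← h0]
      simp
    · have h1 := (hmono z k).trans (real_inner_le_norm _ _)
      refine le_of_mul_le_mul_right ?_ h0
      linarith
  have hwlip : LipschitzWith ε⁻¹.toNNReal w := LipschitzWith.of_dist_le_mul fun x y ↦ by
    rw [Real.coe_toNNReal _ (inv_nonneg.2 hε.le), dist_eq_norm, dist_eq_norm]
    simpa using hlip y (x - y)
  have hbd (z k : E) : |inner ℝ (w z) k| ≤ R * ‖k‖ := (abs_real_inner_le_norm _ _).trans
    (mul_le_mul_of_nonneg_right (hR _ (hwA z)) (norm_nonneg _))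
  refine ⟨f, w, ⟨inv_nonneg.2 hε.le, hwlip.continuous.measurable, fun z ↦ hR _ (hwA z),
    fun z k ↦ abs_le.2 ⟨?_, ?_⟩, fun z k ↦ ?_⟩, fun z ↦ ⟨?_, ?_⟩⟩
  · exact (neg_le_of_abs_le (hbd z k)).trans (hlow z k)
  · exact (hupp z k).trans (le_of_abs_le (hbd (z + k) k))
  · rw [abs_of_nonneg (sub_nonneg.2 (hlow z k))]
    calc f (z + k) - f z - inner ℝ (w z) k ≤ inner ℝ (w (z + k) - w z) k := by
          rw [inner_sub_left]
          exact sub_le_sub_right (hupp z k) _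
      _ ≤ ‖w (z + k) - w z‖ * ‖k‖ := real_inner_le_norm _ _
      _ ≤ ε⁻¹ * ‖k‖ * ‖k‖ := by
          gcongr
          exact hlip z k
      _ = ε⁻¹ * ‖k‖ ^ 2 := by ring
  · have := (hlub z).1 ⟨_, hwA z, rfl⟩
    simp only at this
    have h2 : 0 ≤ ε * ‖w z‖ ^ 2 / 2 := by positivity
    simp only [hf]
    linarith
  · refine (hlub z).2 ?_
    rintro _ ⟨v, hv, rfl⟩
    have h1 := hmax z hv
    have h2 : ε * ‖v‖ ^ 2 ≤ ε * R ^ 2 := by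
      gcongr
      exact hR v hv
    simp only [hf]
    linarith

variable {A : Set E} {R : ℝ} {h : E → ℝ}

lemma abs_supportFunction_le (hne : A.Nonempty) (hR : ∀ v ∈ A, ‖v‖ ≤ R)
    (hlub : ∀ z, IsLUB ((fun v ↦ inner ℝ z v) '' A) (h z)) (z : E) : |h z| ≤ R * ‖z‖ := by
  have hb {v : E} (hv : v ∈ A) : |inner ℝ z v| ≤ R * ‖z‖ := by
    rw [mul_comm]
    exact (abs_real_inner_le_norm _ _).trans (mul_le_mul_of_nonneg_left (hR v hv) (norm_nonneg _))
  obtain ⟨v, hv⟩ := hne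
  refine abs_le.2 ⟨(neg_le_of_abs_le (hb hv)).trans ((hlub z).1 ⟨v, hv, rfl⟩), (hlub z).2 ?_⟩
  rintro _ ⟨v, hv, rfl⟩
  exact le_of_abs_le (hb hv)

lemma continuous_supportFunction (hne : A.Nonempty) (hR : ∀ v ∈ A, ‖v‖ ≤ R)
    (hlub : ∀ z, IsLUB ((fun v ↦ inner ℝ z v) '' A) (h z)) : Continuous h := by
  have hR0 : 0 ≤ R := (norm_nonneg _).trans (hR _ hne.some_mem)
  refine (LipschitzWith.of_le_add_mul R.toNNReal fun x y ↦ (hlub x).2 ?_).continuous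
  rintro _ ⟨v, hv, rfl⟩
  have h1 := (hlub y).1 ⟨v, hv, rfl⟩
  have h2 : inner ℝ (x - y) v ≤ ‖x - y‖ * R :=
    (real_inner_le_norm _ _).trans (mul_le_mul_of_nonneg_left (hR v hv) (norm_nonneg _))
  rw [inner_sub_left] at h2
  rw [Real.coe_toNNReal _ hR0, dist_eq_norm]
  simp only at h1 ⊢
  linarith

variable [FiniteDimensional ℝ E] [MeasurableSpace E] [BorelSpace E]

lemma integrable_supportFunction (hne : A.Nonempty) (hR : ∀ v ∈ A, ‖v‖ ≤ R)
    (hlub : ∀ z, IsLUB ((fun v ↦ inner ℝ z v) '' A) (h z)) (σ : ℝ) :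
    Integrable (fun z ↦ h (σ • z)) (stdGaussian E) := by
  refine (integrable_norm_stdGaussian.const_mul (R * |σ|)).mono'
    ((continuous_supportFunction hne hR hlub).comp (by fun_prop)).aestronglyMeasurable
    (ae_of_all _ fun z ↦ ?_)
  have := abs_supportFunction_le hne hR hlub (σ • z)
  rwa [norm_smul, Real.norm_eq_abs, ← mul_assoc] at this

lemma integrable_exp_supportFunction (hne : A.Nonempty) (hR : ∀ v ∈ A, ‖v‖ ≤ R)
    (hlub : ∀ z, IsLUB ((fun v ↦ inner ℝ z v) '' A) (h z)) (l σ : ℝ) :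
    Integrable (fun z ↦ Real.exp (l * h (σ • z))) (stdGaussian E) := by
  refine (integrable_exp_mul_norm_stdGaussian (|l| * (R * |σ|))).mono'
    (Real.continuous_exp.comp (continuous_const.mul
      ((continuous_supportFunction hne hR hlub).comp (by fun_prop)))).aestronglyMeasurable
    (ae_of_all _ fun z ↦ ?_)
  have := abs_supportFunction_le hne hR hlub (σ • z)
  rw [norm_smul, Real.norm_eq_abs] at this
  rw [Real.norm_of_nonneg (Real.exp_pos _).le]
  refine Real.exp_le_exp.2 ?_
  calc l * h (σ • z) ≤ |l| * |h (σ • z)| := (le_abs_self _).trans (abs_mul _ _).le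
    _ ≤ |l| * (R * (|σ| * ‖z‖)) := by gcongr
    _ = _ := by ring

lemma integral_exp_supportFunction_le (hne : A.Nonempty) (hclosed : IsClosed A)
    (hconv : Convex ℝ A) (hR : ∀ v ∈ A, ‖v‖ ≤ R)
    (hlub : ∀ z, IsLUB ((fun v ↦ inner ℝ z v) '' A) (h z)) {l σ : ℝ} (hl : 0 ≤ l) (hσ : 0 ≤ σ) :
    ∫ z, Real.exp (l * h (σ • z)) ∂(stdGaussian E) ≤
      Real.exp (l * ∫ z, h (σ • z) ∂(stdGaussian E) + (l * σ * R) ^ 2 / 2) := by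
  have hbound (ε : ℝ) (hε : 0 < ε) : ∫ z, Real.exp (l * h (σ • z)) ∂(stdGaussian E) ≤
      Real.exp (l * (ε * R ^ 2 / 2) +
        (l * ∫ z, h (σ • z) ∂(stdGaussian E) + (l * σ * R) ^ 2 / 2)) := by
    obtain ⟨f, w, hf, hfh⟩ := exists_isSmoothLipschitz_approx hne hclosed hconv hR hlub hε
    have hg := hf.comp_smul hl hσ
    have hgi := hg.integrable 0 1
    have hge := hg.integrable_exp 0 1
    simp only [zero_add, one_smul] at hgi hge
    calc ∫ z, Real.exp (l * h (σ • z)) ∂(stdGaussian E)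
        ≤ ∫ z, Real.exp (l * (ε * R ^ 2 / 2)) * Real.exp (l * f (σ • z)) ∂(stdGaussian E) := by
          refine integral_mono (integrable_exp_supportFunction hne hR hlub l σ)
            (hge.const_mul _) fun z ↦ ?_
          simp only
          rw [← Real.exp_add, ← mul_add, add_comm]
          exact Real.exp_le_exp.2 (mul_le_mul_of_nonneg_left (hfh _).2 hl)
      _ ≤ Real.exp (l * (ε * R ^ 2 / 2)) *
          Real.exp (∫ z, l * f (σ • z) ∂(stdGaussian E) + (l * σ * R) ^ 2 / 2) := by
          rw [integral_const_mul]
          exact mul_le_mul_of_nonneg_left hg.integral_exp_le (Real.exp_pos _).le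
      _ ≤ _ := by
          rw [← Real.exp_add, ← integral_const_mul]
          refine Real.exp_le_exp.2 (add_le_add_right (add_le_add_left ?_ _) _)
          exact integral_mono hgi ((integrable_supportFunction hne hR hlub σ).const_mul l)
            fun z ↦ mul_le_mul_of_nonneg_left (hfh _).1 hl
  have hlim : Tendsto (fun ε : ℝ ↦ Real.exp (l * (ε * R ^ 2 / 2) +
      (l * ∫ z, h (σ • z) ∂(stdGaussian E) + (l * σ * R) ^ 2 / 2))) (𝓝[>] 0)
      (𝓝 (Real.exp (l * (0 * R ^ 2 / 2) +
        (l * ∫ z, h (σ • z) ∂(stdGaussian E) + (l * σ * R) ^ 2 / 2)))) :=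
    (Continuous.tendsto (by fun_prop) _).mono_left nhdsWithin_le_nhds
  simp only [zero_mul, zero_div, mul_zero, zero_add] at hlim
  refine ge_of_tendsto hlim ?_
  filter_upwards [self_mem_nhdsWithin] with ε hε using hbound ε hε

/-- The Gaussian concentration inequality, with the sharp constant, for the support function of a
convex set in the ball of radius `R`. -/
theorem measure_supportFunction_ge_le (hne : A.Nonempty) (hclosed : IsClosed A)
    (hconv : Convex ℝ A) (hR : ∀ v ∈ A, ‖v‖ ≤ R) (hRpos : 0 < R)
    (hlub : ∀ z, IsLUB ((fun v ↦ inner ℝ z v) '' A) (h z)) {σ r : ℝ} (hσ : 0 < σ) (hr : 0 ≤ r) :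
    (stdGaussian E).real {z | ∫ y, h (σ • y) ∂(stdGaussian E) + r ≤ h (σ • z)} ≤
      Real.exp (-(r ^ 2 / (2 * (σ * R) ^ 2))) := by
  set l := r / (σ * R) ^ 2
  have hl : 0 ≤ l := by positivity
  refine (measure_ge_le_exp_mul_mgf _ hl
    (integrable_exp_supportFunction hne hR hlub l σ)).trans ?_
  refine (mul_le_mul_of_nonneg_left
    (integral_exp_supportFunction_le hne hclosed hconv hR hlub hl hσ.le)
    (Real.exp_pos _).le).trans_eq ?_
  rw [← Real.exp_add]
  congr 1
  simp only [l]
  field_simp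
  ring

end SupportFunction

/-! ### Least squares over a convex set -/

section LeastSquares

variable {n : ℕ}

lemma scaledNormSq_eq (v : EuclideanSpace ℝ (Fin n)) : scaledNormSq v = ‖v‖ ^ 2 / n := by
  rw [scaledNormSq, EuclideanSpace.real_norm_sq_eq, one_div, inv_mul_eq_div]

lemma multivariateGaussian_sq_smul_one (σ : ℝ) :
    multivariateGaussian 0 (σ ^ 2 • (1 : Matrix (Fin n) (Fin n) ℝ)) =
      (stdGaussian (EuclideanSpace ℝ (Fin n))).map (σ • ·) := by
  have : IsProbabilityMeasure
      ((stdGaussian (EuclideanSpace ℝ (Fin n))).map (σ • · : EuclideanSpace ℝ (Fin n) → _)) :=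
    Measure.isProbabilityMeasure_map (by fun_prop)
  apply Measure.ext_of_charFun
  ext z
  rw [charFun_multivariateGaussian (Matrix.PosSemidef.one.smul (sq_nonneg σ)), charFun_map_smul,
    charFun_stdGaussian, norm_smul]
  have h1 : z.ofLp ⬝ᵥ (σ ^ 2 • (1 : Matrix (Fin n) (Fin n) ℝ)).mulVec z.ofLp =
      (‖σ‖ * ‖z‖) ^ 2 := by
    rw [Matrix.smul_mulVec, Matrix.one_mulVec, dotProduct_smul, mul_pow, Real.norm_eq_abs, sq_abs,
      EuclideanSpace.real_norm_sq_eq, dotProduct, smul_eq_mul]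
    simp_rw [sq]
  rw [h1]
  congr 1
  simp
  ring

variable {K : Set (EuclideanSpace ℝ (Fin n))} {u : EuclideanSpace ℝ (Fin n)} {t : ℝ}

lemma isLUB_localizedSup (hu : u ∈ K) (ht : 0 ≤ t) (z : EuclideanSpace ℝ (Fin n)) :
    IsLUB ((fun v ↦ inner ℝ z v) '' {v | u + v ∈ K ∧ ‖v‖ ≤ t}) (localizedSup K u t z) := by
  have hset : {r : ℝ | ∃ v ∈ K, ‖v - u‖ ≤ t ∧ r = inner ℝ z (v - u)} =
      (fun v ↦ inner ℝ z v) '' {v | u + v ∈ K ∧ ‖v‖ ≤ t} := by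
    ext r
    constructor
    · rintro ⟨v, hv, hvt, rfl⟩
      exact ⟨v - u, ⟨by simpa using hv, hvt⟩, rfl⟩
    · rintro ⟨v, ⟨hv, hvt⟩, rfl⟩
      exact ⟨u + v, hv, by simpa using hvt, by simp⟩
  rw [localizedSup, hset]
  refine isLUB_csSup ⟨_, 0, ⟨by simpa using hu, by simpa using ht⟩, rfl⟩ ⟨‖z‖ * t, ?_⟩
  rintro _ ⟨v, ⟨-, hv⟩, rfl⟩
  exact (real_inner_le_norm _ _).trans (mul_le_mul_of_nonneg_left hv (norm_nonneg _))

lemma IsLeastSquares.inner_le_zero (hK : Convex ℝ K) {y θ : EuclideanSpace ℝ (Fin n)}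
    (h : IsLeastSquares K y θ) (hu : u ∈ K) : inner ℝ (y - θ) (u - θ) ≤ 0 := by
  rcases n.eq_zero_or_pos with rfl | hn
  · simp [Subsingleton.elim (u - θ) 0]
  · have hle (v : K) : ‖y - θ‖ ≤ ‖y - v‖ := by
      have := h.2 v v.2
      rw [scaledNormSq_eq, scaledNormSq_eq, div_le_div_iff_of_pos_right (by positivity)] at this
      exact (pow_le_pow_iff_left₀ (norm_nonneg _) (norm_nonneg _) two_ne_zero).1 this
    have : Nonempty K := ⟨⟨θ, h.1⟩⟩
    have hinf : ‖y - θ‖ = ⨅ w : K, ‖y - w‖ := le_antisymm (le_ciInf hle)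
      (ciInf_le (f := fun w : K ↦ ‖y - w‖) ⟨0, by rintro _ ⟨w, rfl⟩; exact norm_nonneg _⟩ ⟨θ, h.1⟩)
    exact (norm_eq_iInf_iff_real_inner_le_zero hK h.1).1 hinf u hu

/-- The basic inequality for least squares over a convex set; strong convexity of the loss
contributes the term `-‖θ - u‖²`. -/
lemma IsLeastSquares.norm_sq_sub_le (hK : Convex ℝ K) {μ ξ θ : EuclideanSpace ℝ (Fin n)}
    (h : IsLeastSquares K (μ + ξ) θ) (hu : u ∈ K) :
    ‖θ - μ‖ ^ 2 - ‖u - μ‖ ^ 2 ≤ 2 * inner ℝ ξ (θ - u) - ‖θ - u‖ ^ 2 := by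
  have h1 := h.inner_le_zero hK hu
  have h2 := norm_add_sq_real (u - θ) (θ - μ)
  rw [sub_add_sub_cancel] at h2
  rw [show μ + ξ - θ = ξ - (θ - μ) by abel, inner_sub_left, real_inner_comm] at h1
  rw [real_inner_comm] at h2
  rw [norm_sub_rev θ u, ← neg_sub u θ, inner_neg_right]
  rw [real_inner_comm] at h1
  linarith [real_inner_comm (u - θ) (θ - μ)]

/-- On the event that the localized supremum is not too large, the excess risk is at most
`(t + a)² / n`. The fluctuation bound needed is larger than `t² / 2 + t a` by a positive amount,
which makes the final probability bound strict. -/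
lemma IsLeastSquares.scaledNormSq_sub_le (hK : Convex ℝ K) {μ ξ θ : EuclideanSpace ℝ (Fin n)}
    (h : IsLeastSquares K (μ + ξ) θ) (hu : u ∈ K) (ht : 0 < t) {a : ℝ}
    (hsup : localizedSup K u t ξ ≤ t ^ 2 / 2 + (t * a + min (a ^ 2) (t ^ 2) / 2)) :
    scaledNormSq (θ - μ) - scaledNormSq (u - μ) ≤ (t + a) ^ 2 / n := by
  rw [scaledNormSq_eq, scaledNormSq_eq, ← sub_div]
  refine div_le_div_of_nonneg_right ((h.norm_sq_sub_le hK hu).trans ?_) (Nat.cast_nonneg n)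
  set s := ‖θ - u‖
  set X := inner ℝ ξ (θ - u) with hX
  have hlub := isLUB_localizedSup hu ht.le ξ
  rcases le_or_gt s t with hst | hst
  · have h1 : X ≤ _ := (hlub.1 ⟨θ - u, ⟨by simpa using h.1, hst⟩, rfl⟩).trans hsup
    have := min_le_left (a ^ 2) (t ^ 2)
    nlinarith [sq_nonneg s]
  · -- shrink `θ` towards `u` until it reaches the sphere of radius `t`
    have hs : 0 < s := ht.trans hst
    have hmem : u + (t / s) • (θ - u) ∈ K :=
      hK.add_smul_sub_mem hu h.1 ⟨by positivity, (div_le_one hs).2 hst.le⟩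
    have hnorm : ‖(t / s) • (θ - u)‖ ≤ t := by
      rw [norm_smul, Real.norm_of_nonneg (by positivity)]
      exact (div_mul_cancel₀ t hs.ne').le
    have h1 := (hlub.1 ⟨_, ⟨hmem, hnorm⟩, rfl⟩).trans hsup
    simp only at h1
    rw [inner_smul_right, ← hX] at h1
    have h2 : t / s * X ≤ t * (t + a) := by
      have := min_le_right (a ^ 2) (t ^ 2)
      nlinarith
    have h3 : X ≤ s * (t + a) := by
      rw [div_mul_eq_mul_div, div_le_iff₀ hs] at h2
      refine le_of_mul_le_mul_left ?_ ht
      linarith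
    nlinarith [sq_nonneg (t + a - s)]

/-- Under the fixed-point condition on its mean, the localized supremum exceeds `t² / 2 + r` with
probability at most `exp (-r² / (2 σ² t²))`. -/
lemma one_sub_exp_le_measure_localizedSup_le {Ω : Type*} [MeasurableSpace Ω] {P : Measure Ω}
    (hKclosed : IsClosed K) (hKconvex : Convex ℝ K) {σ : ℝ} (hσ : 0 < σ)
    {ξ : Ω → EuclideanSpace ℝ (Fin n)}
    (hξ : HasLaw ξ (multivariateGaussian 0 (σ ^ 2 • (1 : Matrix (Fin n) (Fin n) ℝ))) P)
    (hu : u ∈ K) (ht : 0 < t) (hfix : ∫ ω, localizedSup K u t (ξ ω) ∂P ≤ t ^ 2 / 2)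
    {r : ℝ} (hr : 0 ≤ r) :
    1 - Real.exp (-(r ^ 2 / (2 * (σ * t) ^ 2))) ≤
      P.real {ω | localizedSup K u t (ξ ω) ≤ t ^ 2 / 2 + r} := by
  set A : Set (EuclideanSpace ℝ (Fin n)) := {v | u + v ∈ K ∧ ‖v‖ ≤ t}
  set h := localizedSup K u t
  have hne : A.Nonempty := ⟨0, by simpa using hu, by simpa using ht.le⟩
  have hclosed : IsClosed A := (hKclosed.preimage (by fun_prop)).inter
    (isClosed_le continuous_norm continuous_const)
  have hconv : Convex ℝ A := by
    have hball : Convex ℝ {v : EuclideanSpace ℝ (Fin n) | ‖v‖ ≤ t} := by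
      simpa using (convexOn_norm convex_univ).convex_le t
    exact (hKconvex.translate_preimage_right u).inter hball
  have hR : ∀ v ∈ A, ‖v‖ ≤ t := fun v hv ↦ hv.2
  have hlub : ∀ z, IsLUB ((fun v ↦ inner ℝ z v) '' A) (h z) := isLUB_localizedSup hu ht.le
  have hcont : Continuous h := continuous_supportFunction hne hR hlub
  rw [multivariateGaussian_sq_smul_one] at hξ
  have hmean : ∫ z, h (σ • z) ∂(stdGaussian _) = ∫ ω, h (ξ ω) ∂P := by
    rw [← integral_map (φ := (σ • · : EuclideanSpace ℝ (Fin n) → _)) (by fun_prop)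
      hcont.aestronglyMeasurable, ← hξ.map_eq,
      integral_map hξ.aemeasurable hcont.aestronglyMeasurable]
  have hmeas : MeasurableSet {z | h z ≤ t ^ 2 / 2 + r} :=
    (isClosed_le hcont continuous_const).measurableSet
  have hprob : P.real {ω | h (ξ ω) ≤ t ^ 2 / 2 + r} =
      (stdGaussian (EuclideanSpace ℝ (Fin n))).real {z | h (σ • z) ≤ t ^ 2 / 2 + r} := by
    have h1 := map_measureReal_apply_of_aemeasurable hξ.aemeasurable hmeas
    rw [hξ.map_eq, map_measureReal_apply (by fun_prop) hmeas] at h1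
    exact h1.symm
  have htail := measure_supportFunction_ge_le hne hclosed hconv hR ht hlub hσ hr
  rw [hmean] at htail
  have hcompl := probReal_compl_eq_one_sub (μ := stdGaussian (EuclideanSpace ℝ (Fin n)))
    (s := {z | h (σ • z) ≤ t ^ 2 / 2 + r}) (hmeas.preimage (measurable_const_smul σ))
  have hmono : (stdGaussian (EuclideanSpace ℝ (Fin n))).real
      {z | h (σ • z) ≤ t ^ 2 / 2 + r}ᶜ ≤ _ := (measureReal_mono fun z hz ↦ by
    simp only [Set.mem_compl_iff, Set.mem_ofPred_eq, not_le] at hz ⊢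
    linarith).trans htail
  rw [hprob]
  linarith

end LeastSquares

theorem mainTheorem2 {n : ℕ} {Ω : Type*} [MeasurableSpace Ω] (P : Measure Ω)
    [IsProbabilityMeasure P]
    (K : Set (EuclideanSpace ℝ (Fin n))) (hKclosed : IsClosed K) (hKconvex : Convex ℝ K)
    (μ : EuclideanSpace ℝ (Fin n))
    (σ : ℝ) (hσ : 0 < σ)
    (ξ : Ω → EuclideanSpace ℝ (Fin n))
    (hξ : HasLaw ξ (multivariateGaussian 0 (σ ^ 2 • (1 : Matrix (Fin n) (Fin n) ℝ))) P)
    (muHat : Ω → EuclideanSpace ℝ (Fin n))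
    (hmuHat : ∀ ω, IsLeastSquares K (μ + ξ ω) (muHat ω))
    (u : EuclideanSpace ℝ (Fin n)) (hu : u ∈ K)
    (t : ℝ) (ht : 0 < t)
    (hfix : ∫ ω, localizedSup K u t (ξ ω) ∂P ≤ t ^ 2 / 2)
    (x : ℝ) (hx : 0 < x) :
    1 - Real.exp (-x) <
        P.real {ω | scaledNormSq (muHat ω - μ) - scaledNormSq (u - μ) ≤
          (t + σ * Real.sqrt (2 * x)) ^ 2 / n} ∧
      (t + σ * Real.sqrt (2 * x)) ^ 2 / n ≤ (2 * t ^ 2 + 4 * σ ^ 2 * x) / n := by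
  set a := σ * Real.sqrt (2 * x) with ha
  have hapos : 0 < a := by positivity
  have hasq : a ^ 2 = σ ^ 2 * (2 * x) := by rw [ha, mul_pow, Real.sq_sqrt (by positivity)]
  refine ⟨?_, div_le_div_of_nonneg_right (by nlinarith [sq_nonneg (t - a)]) (Nat.cast_nonneg n)⟩
  set δ := min (a ^ 2) (t ^ 2) / 2
  have hδ : 0 < δ := by positivity
  calc 1 - Real.exp (-x) < 1 - Real.exp (-((t * a + δ) ^ 2 / (2 * (σ * t) ^ 2))) := by
        refine sub_lt_sub_left (Real.exp_lt_exp.2 (neg_lt_neg ?_)) 1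
        rw [lt_div_iff₀ (by positivity)]
        calc x * (2 * (σ * t) ^ 2) = (t * a) ^ 2 := by rw [mul_pow t a, hasq]; ring
          _ < (t * a + δ) ^ 2 := by gcongr; linarith
    _ ≤ P.real {ω | localizedSup K u t (ξ ω) ≤ t ^ 2 / 2 + (t * a + δ)} :=
        one_sub_exp_le_measure_localizedSup_le hKclosed hKconvex hσ hξ hu ht hfix (by positivity)
    _ ≤ _ := measureReal_mono fun ω hω ↦
        (hmuHat ω).scaledNormSq_sub_le hKconvex hu ht hω
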